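/- Let $\Omega\subset\mathbb{R}^d$ be compact and convex with non-empty interior, and let $V$ be a finite-dimensional real inner product space. Equip $V^d$ with the (Frobenius) inner product $\langle u,v\rangle_{V^d}=\sum_{l=1}^d\langle u_l,v_l\rangle_V$ and its norm $|\cdot|_{V^d}$. Let $\mathcal M(\Omega;V)$ and $\mathcal M(\Omega;V^d)$ be the spaces of finite Borel vector measures on $\Omega$ with values in $V$ and $V^d$, and write $\int_\Omega|\sigma|_{V^d}$ for the total variation of $\sigma\in\mathcal M(\Omega;V^d)$ with respect to $|\cdot|_{V^d}$. For $\phi\in C(\Omega;V)$ put $$|\nabla\phi|_{V^d,\infty}:=\sup\Big\{\int_\Omega\langle\phi,\operatorname{div}\psi\rangle_V\,dx \;:\; \psi\in C_c^\infty(\operatorname{int}\Omega;V^d),\ \int_\Omega|\psi|_{V^d}\,dx\le 1\Big\}\in[0,\infty],$$ where $\operatorname{div}\psi=\sum_{l=1}^d\partial_l\psi_l$. For $\sigma\in\mathcal M(\Omega;V^d)$ and $\delta\in\mathcal M(\Omega;V)$, the equation $\operatorname{div}\sigma=\delta$ (with zero flux boundary conditions) means that $-\int_\Omega\langle\nabla\phi,\sigma\rangle_{V^d}=\int_\Omega\langle\phi,\delta\rangle_V$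 for all $\phi\in C^1(\Omega;V)$. Then for all $\mu,\nu\in\mathcal M(\Omega;V)$ with $\mu(\Omega)=\nu(\Omega)$, $$\sup\Big\{\int_\Omega\langle\phi,\nu-\mu\rangle_V \;:\; \phi\in C(\Omega;V),\ |\nabla\phi|_{V^d,\infty}\le 1\Big\}=\inf\Big\{\int_\Omega|\sigma|_{V^d}\;:\;\sigma\in\mathcal M(\Omega;V^d),\ \operatorname{div}\sigma=\mu-\nu\Big\},$$ and the infimum on the right is finite and is attained by some $\sigma\in\mathcal M(\Omega;V^d)$. -/

import Mathlib

open MeasureTheory Set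
open scoped ContDiff ENNReal InnerProductSpace

noncomputable section

namespace VectorBeckmann

/-- The space `V^d` with the inner product `∑ l, ⟪u l, v l⟫` (Frobenius). -/
abbrev Pow (V : Type*) (d : ℕ) : Type _ := PiLp 2 (fun _ : Fin d => V)

variable {d : ℕ} {V : Type*} [NormedAddCommGroup V] [InnerProductSpace ℝ V]

/-- The `l`-th canonical basis vector of `ℝ^d`. -/
abbrev stdVec (l : Fin d) : EuclideanSpace ℝ (Fin d) := EuclideanSpace.single l 1

/-- The pairing `∫_Ω ⟨f, μ⟩` of a function with a vector measure, both valued in the inner product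
space `W`. -/
def pairing {X : Type*} [MeasurableSpace X] {W : Type*} [NormedAddCommGroup W]
    [InnerProductSpace ℝ W] (f : X → W) (μ : VectorMeasure X W) : ℝ :=
  μ.integral f (innerSL ℝ)

/-- The gradient `∇φ(x) ∈ V^d`, with components the partial derivatives of `φ` at `x`
relative to `Ω` (one-sided at boundary points). -/
def grad (Ω : Set (EuclideanSpace ℝ (Fin d))) (φ : EuclideanSpace ℝ (Fin d) → V)
    (x : EuclideanSpace ℝ (Fin d)) : Pow V d :=
  WithLp.toLp 2 fun l => fderivWithin ℝ φ Ω x (stdVec l)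

/-- The divergence `div ψ(x) = ∑ l, ∂_l ψ_l(x) ∈ V` of a `V^d`-valued field. -/
def divergence (ψ : EuclideanSpace ℝ (Fin d) → Pow V d) (x : EuclideanSpace ℝ (Fin d)) : V :=
  ∑ l, fderiv ℝ (fun y => ψ y l) x (stdVec l)

/-- Lebesgue measure on `Ω`, as a measure on the subtype. -/
def lebesgueOn (Ω : Set (EuclideanSpace ℝ (Fin d))) : Measure Ω :=
  volume.comap Subtype.val

/-- The test fields `C_c^∞(int Ω; V^d)`. -/
def IsTestField (Ω : Set (EuclideanSpace ℝ (Fin d)))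
    (ψ : EuclideanSpace ℝ (Fin d) → Pow V d) : Prop :=
  ContDiff ℝ ∞ ψ ∧ HasCompactSupport ψ ∧ tsupport ψ ⊆ interior Ω

/-- The Frobenius-Lipschitz constant `|∇φ|_{V^d,∞} ∈ [0,∞]` of a continuous function: the supremum
of `∫_Ω ⟨φ, div ψ⟩` over the test fields `ψ` with `∫_Ω |ψ|_{V^d} ≤ 1`. -/
def frLipConst {Ω : Set (EuclideanSpace ℝ (Fin d))} (φ : C(Ω, V)) : EReal :=
  ⨆ (ψ : EuclideanSpace ℝ (Fin d) → Pow V d) (_ : IsTestField Ω ψ)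
    (_ : ∫ x, ‖ψ x‖ ∂lebesgueOn Ω ≤ 1), ((∫ x, ⟪φ x, divergence ψ x⟫_ℝ ∂lebesgueOn Ω : ℝ) : EReal)

/-- The value of the dual problem
`sup { ∫_Ω ⟨φ, ν - μ⟩ : φ ∈ C(Ω;V), |∇φ|_{V^d,∞} ≤ 1 }`. -/
def dualValue {Ω : Set (EuclideanSpace ℝ (Fin d))} (μ ν : VectorMeasure Ω V) : EReal :=
  ⨆ (φ : C(Ω, V)) (_ : frLipConst φ ≤ 1), ((pairing φ (ν - μ) : ℝ) : EReal)

/-- `div σ = δ` on `Ω` with zero flux through the boundary: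
`-∫_Ω ⟨∇φ, σ⟩ = ∫_Ω ⟨φ, δ⟩` for all `φ ∈ C¹(Ω;V)`. -/
def HasDivergence {Ω : Set (EuclideanSpace ℝ (Fin d))} (σ : VectorMeasure Ω (Pow V d))
    (δ : VectorMeasure Ω V) : Prop :=
  ∀ φ : EuclideanSpace ℝ (Fin d) → V, ContDiffOn ℝ 1 φ Ω →
    -pairing (fun x : Ω => grad Ω φ x) σ = pairing (fun x : Ω => φ x) δ

/-- The total variation `∫_Ω |σ|_{V^d}`. -/
def totalVar {Ω : Set (EuclideanSpace ℝ (Fin d))} (σ : VectorMeasure Ω (Pow V d)) : ℝ≥0∞ :=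
  σ.variation univ

/-- The value of the Beckmann problem
`inf { ∫_Ω |σ|_{V^d} : σ ∈ M(Ω;V^d), div σ = μ - ν }` (it is `∞` if no `σ` is admissible). -/
def beckmannValue {Ω : Set (EuclideanSpace ℝ (Fin d))} (μ ν : VectorMeasure Ω V) : ℝ≥0∞ :=
  ⨅ (σ : VectorMeasure Ω (Pow V d)) (_ : HasDivergence σ (μ - ν)), totalVar σ

end VectorBeckmann

end

/-! Let `s` be the dual value. Mass balance makes the pairing with `ν - μ` blind to constants, and
on a convex set a `C¹` function with gradient at most one is 1-Lipschitz, so `s` is finite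
(`exists_dualValue_le`). By homogeneity |∫⟨φ, ν - μ⟩| ≤ s ‖∇φ‖_∞ for every `C¹` function `φ`. Hence
∇φ ↦ ∫⟨φ, ν - μ⟩ is a well-defined functional of norm at most `s` on the gradients inside `C(Ω, Pow
V d)`. Hahn–Banach extends it with the same bound, and Riesz represents the extension by a vector
measure `σ` of total variation at most `s`. On gradients this representation is exactly the
divergence equation.

The converse inequality is immediate for `C¹` competitors. A continuous `φ` satisfying only the weak
bound is a uniform limit of `C¹` functions with gradient at most one (`exists_contDiff_approx`):
contract `Ω` towards an interior point, then mollify.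

The Riesz theorem must not lose a constant for the Frobenius norm, so it is not proved
coordinatewise. The functional |L|(f) = sup {L g : |g| ≤ f} gives a scalar measure `m`; `L` then
extends to L¹(m) with norm at most one, and its values on indicators define `σ`. -/

namespace VectorBeckmann

open Filter Topology
open scoped NNReal CompactlySupported

/-! ### Hahn–Banach extension of dominated functionals -/

section HahnBanach

/-- A linear functional on `D` that is dominated by `C * ‖T x‖` factors through `T` via a continuous
linear functional of norm at most `C`. -/
theorem exists_clm_comp_eq_of_abs_le {D E : Type*} [AddCommGroup D] [Module ℝ D]
    [NormedAddCommGroup E] [NormedSpace ℝ E] (T : D →ₗ[ℝ] E) (ℓ : D →ₗ[ℝ] ℝ) {C : ℝ}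
    (hC : 0 ≤ C) (h : ∀ x, |ℓ x| ≤ C * ‖T x‖) :
    ∃ L : E →L[ℝ] ℝ, (∀ x, L (T x) = ℓ x) ∧ ‖L‖ ≤ C := by
  have hker : LinearMap.ker T ≤ LinearMap.ker ℓ := fun x hx => by
    have := h x
    rw [LinearMap.mem_ker.1 hx, norm_zero, mul_zero] at this
    exact abs_nonpos_iff.1 this
  let m : LinearMap.range T →ₗ[ℝ] ℝ :=
    ((LinearMap.ker T).liftQ ℓ hker).comp T.quotKerEquivRange.symm.toLinearMap
  have hm : ∀ x, m ⟨T x, x, rfl⟩ = ℓ x := fun x => by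
    have : T.quotKerEquivRange.symm ⟨T x, x, rfl⟩ = (LinearMap.ker T).mkQ x := by
      rw [LinearEquiv.symm_apply_eq]; rfl
    simp only [m, LinearMap.comp_apply, LinearEquiv.coe_coe]
    rw [this]
    simp
  let m' : StrongDual ℝ (LinearMap.range T) := m.mkContinuous C (by
    rintro ⟨_, x, rfl⟩
    rw [hm]
    exact h x)
  obtain ⟨L, hL, hn⟩ := exists_extension_norm_eq (LinearMap.range T) m'
  refine ⟨L, fun x => ?_, ?_⟩
  · rw [← hm x]
    exact hL ⟨T x, x, rfl⟩
  · rw [hn]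
    exact LinearMap.mkContinuous_norm_le _ hC _

end HahnBanach

/-! ### The absolute value of a functional on continuous fields -/

section Riesz

variable {X : Type*} [TopologicalSpace X]
  {W : Type*} [NormedAddCommGroup W] [InnerProductSpace ℝ W]

/-- The supremum of `L g` over the continuous fields `g` with `‖g‖ ≤ f` pointwise. -/
noncomputable def absFunctional (L : C(X, W) →L[ℝ] ℝ) (f : X → ℝ≥0) : ℝ :=
  sSup {r : ℝ | ∃ g : C(X, W), (∀ x, ‖g x‖ ≤ f x) ∧ L g = r}

variable (L : C(X, W) →L[ℝ] ℝ)

theorem absFunctional_le (f : X → ℝ≥0) {c : ℝ}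
    (h : ∀ g : C(X, W), (∀ x, ‖g x‖ ≤ f x) → L g ≤ c) : absFunctional L f ≤ c := by
  refine csSup_le ⟨0, 0, by simp, by simp⟩ ?_
  rintro _ ⟨k, hk, rfl⟩
  exact h k hk

variable [CompactSpace X]

theorem le_absFunctional (f : C(X, ℝ≥0)) (g : C(X, W)) (h : ∀ x, ‖g x‖ ≤ f x) :
    L g ≤ absFunctional L f := by
  obtain ⟨c, hc⟩ := (isCompact_range f.continuous).bddAbove
  refine le_csSup ⟨‖L‖ * c, ?_⟩ ⟨g, h, rfl⟩
  rintro _ ⟨k, hk, rfl⟩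
  refine (le_abs_self _).trans ((L.le_opNorm k).trans ?_)
  gcongr
  refine (ContinuousMap.norm_le _ c.coe_nonneg).2 fun x => (hk x).trans ?_
  exact_mod_cast hc ⟨x, rfl⟩

theorem absFunctional_nonneg (f : C(X, ℝ≥0)) : 0 ≤ absFunctional L f := by
  simpa using le_absFunctional L f 0 (by simp)

/-- Competitors for `f₁` and `f₂` add up to one for the sum. Conversely, a competitor `g` for the
sum is split with weights `fᵢ / (f₁ + f₂ + ε)`; the `ε` is needed because `f₁ + f₂` may vanish, and
it leaves a remainder of norm at most `ε`. -/
theorem absFunctional_add (f₁ f₂ : C(X, ℝ≥0)) :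
    absFunctional L (f₁ + f₂ : C(X, ℝ≥0)) = absFunctional L f₁ + absFunctional L f₂ := by
  apply le_antisymm
  · refine absFunctional_le L _ fun g hg => ?_
    refine le_of_forall_pos_le_add fun η hη => ?_
    obtain ⟨ε, hε, hεη⟩ : ∃ ε : ℝ, 0 < ε ∧ ‖L‖ * ε ≤ η := by
      refine ⟨η / (‖L‖ + 1), by positivity, ?_⟩
      rw [mul_div_assoc', div_le_iff₀ (by positivity)]
      nlinarith [norm_nonneg L]
    have hs : ∀ x, 0 < (f₁ x : ℝ) + f₂ x + ε := fun x => by positivity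
    let w : C(X, ℝ≥0) → C(X, W) := fun f =>
      ⟨fun x => ((f x : ℝ) / (f₁ x + f₂ x + ε)) • g x, by
        refine Continuous.smul (Continuous.div (by fun_prop) (by fun_prop) fun x => (hs x).ne')
          g.continuous⟩
    have hg' : ∀ x, ‖g x‖ ≤ f₁ x + f₂ x := fun x => by simpa using hg x
    have hw : ∀ f : C(X, ℝ≥0), ∀ x, ‖w f x‖ ≤ f x := fun f x => by
      simp only [w, ContinuousMap.coe_mk, norm_smul, Real.norm_eq_abs]
      rw [abs_of_nonneg (by have := hs x; positivity), div_mul_eq_mul_div, div_le_iff₀ (hs x)]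
      gcongr
      linarith [hg' x]
    have hr : ‖g - (w f₁ + w f₂)‖ ≤ ε := by
      refine (ContinuousMap.norm_le _ hε.le).2 fun x => ?_
      have : (g - (w f₁ + w f₂)) x = (ε / (f₁ x + f₂ x + ε)) • g x := by
        simp only [w, ContinuousMap.sub_apply, ContinuousMap.add_apply, ContinuousMap.coe_mk]
        nth_rewrite 1 [← one_smul ℝ (g x)]
        rw [← add_smul, ← sub_smul]
        congr 1
        field_simp [(hs x).ne']
        ring
      rw [this, norm_smul, Real.norm_eq_abs,
        abs_of_nonneg (by have := hs x; positivity), div_mul_eq_mul_div, div_le_iff₀ (hs x)]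
      gcongr
      linarith [hg' x]
    have h1 := le_absFunctional L f₁ (w f₁) (hw f₁)
    have h2 := le_absFunctional L f₂ (w f₂) (hw f₂)
    have h3 : L (g - (w f₁ + w f₂)) ≤ η :=
      (le_abs_self _).trans ((L.le_opNorm _).trans ((by gcongr : _ ≤ ‖L‖ * ε).trans hεη))
    simp only [map_sub, map_add] at h3
    linarith
  · rw [← le_sub_iff_add_le]
    refine absFunctional_le L _ fun g₁ h₁ => ?_
    rw [le_sub_comm]
    refine absFunctional_le L _ fun g₂ h₂ => ?_
    rw [le_sub_iff_add_le, add_comm, ← map_add]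
    refine le_absFunctional L _ _ fun x => ?_
    simpa using (norm_add_le _ _).trans (add_le_add (h₁ x) (h₂ x))

theorem absFunctional_smul (c : ℝ≥0) (f : C(X, ℝ≥0)) :
    absFunctional L (c • f : C(X, ℝ≥0)) = c * absFunctional L f := by
  -- Rescaling competitors gives one inequality; the other is the same one for `c⁻¹` and `c • f`.
  have key : ∀ (c : ℝ≥0) (f : C(X, ℝ≥0)), c ≠ 0 →
      absFunctional L (c • f : C(X, ℝ≥0)) ≤ c * absFunctional L f := fun c f hc => by
    refine absFunctional_le L _ fun g hg => ?_
    have hc' : (0 : ℝ) < c := by positivity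
    have := le_absFunctional L f ((c : ℝ)⁻¹ • g) fun x => by
      have := hg x
      simp only [ContinuousMap.coe_smul, Pi.smul_apply, smul_eq_mul, NNReal.coe_mul] at this
      rw [ContinuousMap.smul_apply, norm_smul, norm_inv, NNReal.norm_eq,
        inv_mul_le_iff₀ hc']
      exact this
    rwa [map_smul, smul_eq_mul, inv_mul_le_iff₀ hc'] at this
  rcases eq_or_ne c 0 with rfl | hc
  · rw [NNReal.coe_zero, zero_mul]
    refine le_antisymm (absFunctional_le L _ fun g hg => ?_) (absFunctional_nonneg L _)
    have : g = 0 := by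
      ext x
      simpa using hg x
    simp [this]
  · refine le_antisymm (key c f hc) ?_
    have := key c⁻¹ (c • f) (inv_ne_zero hc)
    rw [smul_smul, inv_mul_cancel₀ hc, one_smul, NNReal.coe_inv,
      le_inv_mul_iff₀ (by positivity)] at this
    exact this

variable [T2Space X] [MeasurableSpace X] [BorelSpace X]

/-- A continuous functional on `C(X, W)` is dominated by integration of the norm against a finite
measure of mass at most the norm of the functional. -/
theorem exists_measure_abs_le_integral_norm :
    ∃ m : Measure X, IsFiniteMeasure m ∧ m.real univ ≤ ‖L‖ ∧
      ∀ g : C(X, W), |L g| ≤ ∫ x, ‖g x‖ ∂m := by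
  let Λ : C_c(X, ℝ≥0) →ₗ[ℝ≥0] ℝ≥0 :=
    { toFun := fun f => ⟨absFunctional L f.toContinuousMap, absFunctional_nonneg L _⟩
      map_add' := fun f g => NNReal.eq (absFunctional_add L f.toContinuousMap g.toContinuousMap)
      map_smul' := fun c f => NNReal.eq (absFunctional_smul L c f.toContinuousMap) }
  have hΛ : ∀ f : C(X, ℝ≥0), ∫ x, (f x : ℝ) ∂(NNRealRMK.rieszMeasure Λ) = absFunctional L f :=
    fun f => NNRealRMK.integral_rieszMeasure Λ ⟨f, HasCompactSupport.of_compactSpace f⟩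
  refine ⟨NNRealRMK.rieszMeasure Λ, inferInstance, ?_, fun g => ?_⟩
  -- The total mass is |L|(1), whose competitors form the unit ball of `C(X, W)`.
  · have h1 := hΛ 1
    simp only [ContinuousMap.one_apply, NNReal.coe_one, integral_const, smul_eq_mul, mul_one] at h1
    rw [h1]
    refine absFunctional_le L _ fun g hg => ?_
    refine (le_abs_self _).trans ((L.le_opNorm g).trans ?_)
    refine mul_le_of_le_one_right (norm_nonneg _) ?_
    exact (ContinuousMap.norm_le _ zero_le_one).2 fun x => by simpa using hg x
  · have h1 := hΛ ⟨fun x => ‖g x‖₊, by fun_prop⟩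
    simp only [ContinuousMap.coe_mk, coe_nnnorm] at h1
    rw [h1, abs_le']
    refine ⟨le_absFunctional L ⟨fun x => ‖g x‖₊, by fun_prop⟩ g fun x => by simp, ?_⟩
    rw [← map_neg]
    exact le_absFunctional L ⟨fun x => ‖g x‖₊, by fun_prop⟩ (-g) fun x => by simp

end Riesz

/-! ### Riesz representation by vector measures -/

section Riesz

variable {X : Type*} [MeasurableSpace X]
  {W : Type*} [NormedAddCommGroup W] [InnerProductSpace ℝ W]

/-- The functional `w ↦ M (w 1_s)` on `W` induced by a functional `M` on `L¹`. -/
noncomputable def indicatorFunctional {m : Measure X} [IsFiniteMeasure m]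
    (M : Lp W 1 m →L[ℝ] ℝ) {s : Set X} (hs : MeasurableSet s) : W →L[ℝ] ℝ :=
  LinearMap.mkContinuous
    { toFun := fun w => M (indicatorConstLp 1 hs (measure_ne_top m s) w)
      map_add' := fun v w => by rw [← map_add, indicatorConstLp_add]
      map_smul' := fun c w => by
        rw [RingHom.id_apply, ← map_smul]
        congr 1
        apply Lp.ext
        filter_upwards [indicatorConstLp_coeFn (p := 1) (hs := hs) (hμs := measure_ne_top m s)
            (c := c • w), indicatorConstLp_coeFn (p := 1) (hs := hs) (hμs := measure_ne_top m s)
            (c := w), Lp.coeFn_smul c (indicatorConstLp 1 hs (measure_ne_top m s) w)]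
          with x h1 h2 h3
        rw [h1, h3, Pi.smul_apply, h2]
        exact congrFun (Set.indicator_const_smul s c fun _ => w) x }
    (‖M‖ * m.real s) fun w => by
      refine (M.le_opNorm _).trans ?_
      rw [norm_indicatorConstLp one_ne_zero ENNReal.one_ne_top]
      simp [mul_comm, mul_left_comm]

theorem indicatorFunctional_apply {m : Measure X} [IsFiniteMeasure m]
    (M : Lp W 1 m →L[ℝ] ℝ) {s : Set X} (hs : MeasurableSet s) (w : W) :
    indicatorFunctional M hs w = M (indicatorConstLp 1 hs (measure_ne_top m s) w) := rfl

theorem norm_indicatorFunctional_le {m : Measure X} [IsFiniteMeasure m]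
    (M : Lp W 1 m →L[ℝ] ℝ) {s : Set X} (hs : MeasurableSet s) :
    ‖indicatorFunctional M hs‖ ≤ ‖M‖ * m.real s :=
  LinearMap.mkContinuous_norm_le _ (by positivity) _

variable [FiniteDimensional ℝ W]

/-- Functionals of norm at most one on `L¹(m; W)` are given by vector measures dominated by `m`. -/
theorem exists_vectorMeasure_pairing_eq_of_L1 {m : Measure X} [IsFiniteMeasure m]
    (M : Lp W 1 m →L[ℝ] ℝ) (hM : ‖M‖ ≤ 1) :
    ∃ σ : VectorMeasure X W, σ.variation ≤ m ∧
      ∀ f : X → W, ∀ hf : Integrable f m, pairing f σ = M (hf.toL1 f) := by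
  classical
  -- `σ s` is the vector representing `w ↦ M (w 1_s)`. Additivity is clear only for finite unions;
  -- domination by the finite measure `m` makes it countable.
  let σ : VectorMeasure X W := VectorMeasure.of_additive_of_le_measure (μ := m)
    (fun s => if hs : MeasurableSet s then
      (InnerProductSpace.toDual ℝ W).symm (indicatorFunctional M hs) else 0)
    (fun s => by
      split_ifs with hs
      · rw [← ofReal_norm, LinearIsometryEquiv.norm_map]
        refine ENNReal.ofReal_le_of_le_toReal ((norm_indicatorFunctional_le M hs).trans ?_)
        exact mul_le_of_le_one_left measureReal_nonneg hM
      · simp)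
    (fun s t hs ht hst => by
      rw [dif_pos hs, dif_pos ht, dif_pos (hs.union ht), ← map_add]
      congr 1
      ext w
      rw [add_apply, indicatorFunctional_apply, indicatorFunctional_apply,
        indicatorFunctional_apply, ← map_add, indicatorConstLp_disjoint_union hs ht
          (measure_ne_top m s) (measure_ne_top m t) hst])
    (fun s hs => dif_neg hs)
  have hσ : ∀ {s : Set X} (hs : MeasurableSet s),
      σ s = (InnerProductSpace.toDual ℝ W).symm (indicatorFunctional M hs) := fun hs => dif_pos hs
  have hle : ∀ s, MeasurableSet s → ‖σ s‖ ≤ m.real s := fun s hs => by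
    rw [hσ hs, LinearIsometryEquiv.norm_map]
    exact (norm_indicatorFunctional_le M hs).trans
      (mul_le_of_le_one_left measureReal_nonneg hM)
  have hvar : σ.variation ≤ m := VectorMeasure.variation_le_of_forall_enorm_le fun s hs => by
    rw [← ofReal_norm]
    exact ENNReal.ofReal_le_of_le_toReal (hle s hs)
  have hT : DominatedFinMeasAdditive m (σ.transpose (innerSL ℝ)) 1 := by
    refine ⟨fun s t hs ht _ _ hst => cbmApplyMeasure_union σ (innerSL ℝ) hs ht hst,
      fun s hs _ => ?_⟩
    refine (norm_cbmApplyMeasure_le σ (innerSL ℝ) s).trans ?_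
    gcongr
    · exact norm_innerSL_le ℝ
    · exact hle s hs
  refine ⟨σ, hvar, fun f hf => ?_⟩
  -- The pairing is an integral with respect to the variation of `σ`. Since that variation is at
  -- most `m`, it can be computed on L¹(m), where `M` lives.
  have hpair : ∀ f : X → W, Integrable f m →
      pairing f σ = setToFun m (σ.transpose (innerSL ℝ)) hT f := fun f hf =>
    (setToFun_congr_measure_of_integrable 1 ENNReal.one_ne_top (by simpa using hvar) hT _ f hf).symm
  rw [hpair f hf]
  revert hf
  -- The integrability proof is quantified anew, so that the induction predicate depends on `f`
  -- alone.
  suffices H : ∀ ⦃f : X → W⦄, Integrable f m → ∀ hf : Integrable f m,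
      setToFun m (σ.transpose (innerSL ℝ)) hT f = M (hf.toL1 f) from fun hf => H hf hf
  refine Integrable.induction (fun f => ∀ hf : Integrable f m,
    setToFun m (σ.transpose (innerSL ℝ)) hT f = M (hf.toL1 f)) ?_ ?_ ?_ ?_
  · intro c s hs hms hf
    rw [setToFun_indicator_const hT hs hms.ne]
    have : (σ.transpose (innerSL ℝ)) s c = ⟪σ s, c⟫_ℝ := (real_inner_comm _ _)
    rw [this, hσ hs, InnerProductSpace.toDual_symm_apply, indicatorFunctional_apply]
    rfl
  · intro f g _ hf hg h1 h2 hfg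
    rw [setToFun_add hT hf hg, h1 hf, h2 hg, ← map_add]
    rfl
  · have : {f : Lp W 1 m | ∀ hf : Integrable f m,
        setToFun m (σ.transpose (innerSL ℝ)) hT f = M (hf.toL1 f)} =
        {f : Lp W 1 m | setToFun m (σ.transpose (innerSL ℝ)) hT f = M f} := by
      ext f
      constructor
      · intro h
        have := h (L1.integrable_coeFn f)
        rwa [Integrable.toL1_coeFn] at this
      · intro h hf
        rw [Integrable.toL1_coeFn]
        exact h
    rw [this]
    exact isClosed_eq (continuous_setToFun hT) M.continuous
  · intro f g hfg hf h hg
    rw [← setToFun_congr_ae hT hfg, h hf, (Integrable.toL1_eq_toL1_iff f g hf hg).2 hfg]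

/-- **Riesz representation** of functionals on continuous vector fields on a compact space by vector
measures. -/
theorem exists_vectorMeasure_pairing_eq [TopologicalSpace X] [CompactSpace X] [T2Space X]
    [BorelSpace X] (L : C(X, W) →L[ℝ] ℝ) :
    ∃ σ : VectorMeasure X W, σ.variation univ ≤ ENNReal.ofReal ‖L‖ ∧
      ∀ g : C(X, W), pairing g σ = L g := by
  obtain ⟨m, hm, hmass, hL⟩ := exists_measure_abs_le_integral_norm L
  have : ProperSpace W := FiniteDimensional.proper ℝ W
  -- The bound by ∫ |g| dm says that `L` factors with norm at most one through the map into L¹(m).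
  obtain ⟨M, hML, hM⟩ := exists_clm_comp_eq_of_abs_le
    (ContinuousMap.toLp (E := W) 1 m ℝ).toLinearMap L.toLinearMap zero_le_one fun g => by
      rw [one_mul]
      refine (hL g).trans_eq ?_
      rw [L1.norm_eq_integral_norm]
      refine integral_congr_ae ?_
      filter_upwards [ContinuousMap.coeFn_toLp (p := 1) (𝕜 := ℝ) m g] with x hx
      rw [ContinuousLinearMap.coe_coe, hx]
  obtain ⟨σ, hvar, hσ⟩ := exists_vectorMeasure_pairing_eq_of_L1 M hM
  refine ⟨σ, (hvar univ).trans ?_, fun g => ?_⟩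
  · rw [← ENNReal.ofReal_toReal (measure_ne_top m univ)]
    exact ENNReal.ofReal_le_ofReal hmass
  · have hg : Integrable g m :=
      (L1.integrable_coeFn (ContinuousMap.toLp (E := W) 1 m ℝ g)).congr
        (ContinuousMap.coeFn_toLp m g)
    rw [hσ g hg]
    have : hg.toL1 g = ContinuousMap.toLp (E := W) 1 m ℝ g := by
      apply Lp.ext
      filter_upwards [hg.coeFn_toL1, ContinuousMap.coeFn_toLp (p := 1) (𝕜 := ℝ) m g] with x h1 h2
      rw [h1, h2]
    rw [this]
    exact hML g

end Riesz

/-! ### Finiteness of the variation and bounds on the pairing -/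

section Variation

variable {X : Type*} [MeasurableSpace X]
  {W : Type*} [NormedAddCommGroup W] [InnerProductSpace ℝ W] [FiniteDimensional ℝ W]

/-- Vector measures with values in a finite-dimensional space have finite variation. -/
theorem isFiniteMeasure_variation (μ : VectorMeasure X W) : IsFiniteMeasure μ.variation := by
  let b := stdOrthonormalBasis ℝ W
  let c : Fin (Module.finrank ℝ W) → SignedMeasure X := fun i =>
    μ.mapRange (innerSL ℝ (b i) : W →+ ℝ) (innerSL ℝ (b i)).continuous
  have hc : ∀ i s, c i s = ⟪b i, μ s⟫_ℝ := fun i s => rfl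
  -- In an orthonormal basis the coordinates are signed measures, whose total variations are finite.
  have hle : μ.variation ≤ ∑ i, (c i).totalVariation := by
    refine VectorMeasure.variation_le_of_forall_enorm_le fun s hs => ?_
    rw [Measure.finsetSum_apply]
    calc ‖μ s‖ₑ = ‖∑ i, ⟪b i, μ s⟫_ℝ • b i‖ₑ := by rw [b.sum_repr']
      _ ≤ ∑ i, ‖⟪b i, μ s⟫_ℝ • b i‖ₑ := enorm_sum_le _ _
      _ ≤ ∑ i, (c i).totalVariation s := by
        gcongr with i
        rw [enorm_smul, ← ofReal_norm (b i), b.norm_eq_one, ENNReal.ofReal_one, mul_one, ← hc]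
        exact SignedMeasure.enorm_le_totalVariation _ _
  refine isFiniteMeasure_of_le _ hle

/-- Bound on the pairing by the supremum norm times the total variation. -/
theorem abs_pairing_le (μ : VectorMeasure X W) {f : X → W} {C : ℝ} (hf : ∀ x, ‖f x‖ ≤ C) :
    |pairing f μ| ≤ C * μ.variation.real univ := by
  have := isFiniteMeasure_variation μ
  -- On an empty space `C` may be negative.
  rcases isEmpty_or_nonempty X with hX | ⟨⟨x⟩⟩
  · have : pairing f μ = 0 := VectorMeasure.integral_of_isEmpty
    simp [this, Measure.real, Set.eq_empty_of_isEmpty]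
  have hC : 0 ≤ C := (norm_nonneg _).trans (hf x)
  refine (VectorMeasure.norm_integral_le_of_norm_le_const (μ := μ) (B := innerSL ℝ)
    (Eventually.of_forall hf)).trans ?_
  gcongr
  exact mul_le_of_le_one_right hC (norm_innerSL_le ℝ)

theorem vectorMeasure_integrable [TopologicalSpace X] [CompactSpace X] [BorelSpace X]
    (μ : VectorMeasure X W) {f : X → W} (hf : Continuous f) : μ.Integrable f := by
  have := isFiniteMeasure_variation μ
  have : ProperSpace W := FiniteDimensional.proper ℝ W
  exact hf.integrable_of_hasCompactSupport (HasCompactSupport.of_compactSpace f)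

end Variation

/-! ### Gradients, integration by parts and smooth dual competitors -/

section Gradient

theorem tsupport_component_subset {d : ℕ} {V : Type*} [NormedAddCommGroup V]
    (ψ : EuclideanSpace ℝ (Fin d) → Pow V d) (l : Fin d) :
    tsupport (fun y => ψ y l) ⊆ tsupport ψ :=
  closure_mono fun x hx hψ => hx (by simp [hψ])

variable {d : ℕ} {V : Type*} [NormedAddCommGroup V] [InnerProductSpace ℝ V]
  {Ω : Set (EuclideanSpace ℝ (Fin d))}

/-- The operator norm of a linear map is bounded by its Frobenius norm. -/
theorem norm_le_frobenius (D : EuclideanSpace ℝ (Fin d) →L[ℝ] V) :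
    ‖D‖ ≤ ‖(WithLp.toLp 2 fun l => D (stdVec l) : Pow V d)‖ := by
  refine D.opNorm_le_bound (norm_nonneg _) fun v => ?_
  have hv : D v = ∑ l, v l • D (stdVec l) := by
    have : v = ∑ l, v l • stdVec l := by
      simpa using ((EuclideanSpace.basisFun (Fin d) ℝ).sum_repr v).symm
    conv_lhs => rw [this]
    simp
  rw [hv, PiLp.norm_eq_of_L2, EuclideanSpace.norm_eq, mul_comm]
  refine (norm_sum_le _ _).trans ?_
  simp only [norm_smul]
  exact Real.sum_mul_le_sqrt_mul_sqrt _ _ _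

theorem integral_lebesgueOn_eq_integral (hΩ : IsClosed Ω) {f : EuclideanSpace ℝ (Fin d) → ℝ}
    (hf : ∀ x, x ∉ Ω → f x = 0) : ∫ x : Ω, f x ∂lebesgueOn Ω = ∫ x, f x := by
  rw [lebesgueOn, integral_subtype_comap hΩ.measurableSet,
    setIntegral_eq_integral_of_forall_compl_eq_zero hf]

theorem IsTestField.eq_zero {ψ : EuclideanSpace ℝ (Fin d) → Pow V d} (hψ : IsTestField Ω ψ)
    {x : EuclideanSpace ℝ (Fin d)} (hx : x ∉ interior Ω) : ψ x = 0 :=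
  image_eq_zero_of_notMem_tsupport fun h => hx (hψ.2.2 h)

theorem IsTestField.contDiff_component {ψ : EuclideanSpace ℝ (Fin d) → Pow V d}
    (hψ : IsTestField Ω ψ) (l : Fin d) : ContDiff ℝ ∞ (fun y => ψ y l) :=
  (contDiff_piLp 2).1 hψ.1 l

theorem IsTestField.divergence_eq_zero {ψ : EuclideanSpace ℝ (Fin d) → Pow V d}
    (hψ : IsTestField Ω ψ) {x : EuclideanSpace ℝ (Fin d)} (hx : x ∉ interior Ω) :
    divergence ψ x = 0 := by
  refine Finset.sum_eq_zero fun l _ => ?_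
  have : x ∉ tsupport (fun y => ψ y l) := fun h => hx (hψ.2.2 (tsupport_component_subset ψ l h))
  rw [fderiv_of_notMem_tsupport ℝ this, zero_apply]

/-- `f` may be discontinuous off `U`, but the product vanishes near every point outside the support
of `g`, hence is continuous everywhere. -/
theorem integrable_inner_of_tsupport_subset {U : Set (EuclideanSpace ℝ (Fin d))} (hU : IsOpen U)
    {f g : EuclideanSpace ℝ (Fin d) → V} (hf : ContinuousOn f U) (hg : Continuous g)
    (hgc : HasCompactSupport g) (hgU : tsupport g ⊆ U) : Integrable (fun x => ⟪f x, g x⟫_ℝ) := by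
  have hsupp : Function.support (fun x => ⟪f x, g x⟫_ℝ) ⊆ Function.support g :=
    fun x hx hgx => hx (by simp [hgx])
  refine Continuous.integrable_of_hasCompactSupport (continuous_of_tsupport fun x hx => ?_)
    (hgc.mono hsupp)
  exact (hf.continuousAt (hU.mem_nhds (hgU (closure_mono hsupp hx)))).inner hg.continuousAt

/-- Integration by parts against a test field. -/
theorem integral_inner_divergence {φ : EuclideanSpace ℝ (Fin d) → V}
    (hφ : ContDiffOn ℝ 1 φ Ω) {ψ : EuclideanSpace ℝ (Fin d) → Pow V d} (hψ : IsTestField Ω ψ) :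
    Integrable (fun x => ⟪(WithLp.toLp 2 fun l => fderiv ℝ φ x (stdVec l) : Pow V d), ψ x⟫_ℝ) ∧
    ∫ x, ⟪φ x, divergence ψ x⟫_ℝ =
      -∫ x, ⟪(WithLp.toLp 2 fun l => fderiv ℝ φ x (stdVec l) : Pow V d), ψ x⟫_ℝ := by
  have hφ' : ContDiffOn ℝ 1 φ (interior Ω) := hφ.mono interior_subset
  have hcont : ContinuousOn φ (interior Ω) := hφ'.continuousOn
  have hdcont : ∀ l, ContinuousOn (fun x => fderiv ℝ φ x (stdVec l)) (interior Ω) := fun l =>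
    (hφ'.continuousOn_fderiv_of_isOpen isOpen_interior le_rfl).clm_apply continuousOn_const
  have hcomp : ∀ l, HasCompactSupport (fun y => ψ y l) := fun l =>
    hψ.2.1.mono fun x hx hψx => hx (by simp [hψx])
  have hsub : ∀ l, tsupport (fun y => ψ y l) ⊆ interior Ω := fun l =>
    (tsupport_component_subset ψ l).trans hψ.2.2
  have hψd : ∀ l, Continuous fun x => fderiv ℝ (fun y => ψ y l) x (stdVec l) := fun l =>
    ((hψ.contDiff_component l).continuous_fderiv (by simp)).clm_apply continuous_const
  have hψds : ∀ l, Function.support (fun x => fderiv ℝ (fun y => ψ y l) x (stdVec l)) ⊆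
      tsupport (fun y => ψ y l) := fun l x hx => by
    by_contra h
    exact hx (by beta_reduce; rw [fderiv_of_notMem_tsupport ℝ h, zero_apply])
  have hψdc : ∀ l, HasCompactSupport fun x => fderiv ℝ (fun y => ψ y l) x (stdVec l) := fun l =>
    (hcomp l).mono' (hψds l)
  have hψdt : ∀ l, tsupport (fun x => fderiv ℝ (fun y => ψ y l) x (stdVec l)) ⊆ interior Ω :=
    fun l => (closure_minimal (hψds l) (isClosed_tsupport _)).trans (hsub l)
  have i1 : ∀ l, Integrable fun x => ⟪φ x, fderiv ℝ (fun y => ψ y l) x (stdVec l)⟫_ℝ := fun l =>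
    integrable_inner_of_tsupport_subset isOpen_interior hcont (hψd l) (hψdc l) (hψdt l)
  have i2 : ∀ l, Integrable fun x => ⟪fderiv ℝ φ x (stdVec l), ψ x l⟫_ℝ := fun l =>
    integrable_inner_of_tsupport_subset isOpen_interior (hdcont l)
      (hψ.contDiff_component l).continuous (hcomp l) (hsub l)
  have i3 : ∀ l, Integrable fun x => ⟪φ x, ψ x l⟫_ℝ := fun l =>
    integrable_inner_of_tsupport_subset isOpen_interior hcont
      (hψ.contDiff_component l).continuous (hcomp l) (hsub l)
  -- `φ` need not be differentiable outside the interior; differentiability on the support of the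
  -- `l`-th component of `ψ` suffices.
  have hparts : ∀ l, ∫ x, ⟪φ x, fderiv ℝ (fun y => ψ y l) x (stdVec l)⟫_ℝ =
      -∫ x, ⟪fderiv ℝ φ x (stdVec l), ψ x l⟫_ℝ := fun l =>
    integral_bilinear_fderiv_right_eq_neg_left_of_integrable (B := innerSL ℝ) (i2 l) (i1 l) (i3 l)
      (fun x hx => (hφ'.differentiableOn one_ne_zero).differentiableAt
        (isOpen_interior.mem_nhds (hsub l hx)))
      (fun x _ => (hψ.contDiff_component l).differentiable (by simp) x)
  simp only [PiLp.inner_apply]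
  refine ⟨integrable_finsetSum _ fun l _ => i2 l, ?_⟩
  simp only [divergence, inner_sum]
  rw [integral_finsetSum _ fun l _ => i1 l, integral_finsetSum _ fun l _ => i2 l,
    ← Finset.sum_neg_distrib]
  exact Finset.sum_congr rfl fun l _ => hparts l

/-- A `C¹` function whose gradient has Frobenius norm at most one is admissible in the dual
problem. -/
theorem frLipConst_le_one (hΩ : IsClosed Ω) {φ : EuclideanSpace ℝ (Fin d) → V}
    (hφ : ContDiffOn ℝ 1 φ Ω) (hgrad : ∀ x ∈ Ω, ‖grad Ω φ x‖ ≤ 1) (φ' : C(Ω, V))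
    (hφ' : ∀ x : Ω, φ' x = φ x) : frLipConst φ' ≤ 1 := by
  refine iSup_le fun ψ => iSup_le fun hψ => iSup_le fun hle => ?_
  have hψ0 : ∀ x, x ∉ Ω → ψ x = 0 := fun x hx => hψ.eq_zero fun h => hx (interior_subset h)
  obtain ⟨hint, hparts⟩ := integral_inner_divergence hφ hψ
  simp only [hφ']
  rw [integral_lebesgueOn_eq_integral (f := fun x => ‖ψ x‖) hΩ
    fun x hx => by simp [hψ0 x hx]] at hle
  rw [integral_lebesgueOn_eq_integral (f := fun x => ⟪φ x, divergence ψ x⟫_ℝ) hΩ fun x hx => by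
    simp [hψ.divergence_eq_zero fun h => hx (interior_subset h)], hparts, ← integral_neg]
  have hψi : Integrable fun x => ‖ψ x‖ :=
    (hψ.1.continuous.integrable_of_hasCompactSupport hψ.2.1).norm
  have : ∫ x, -⟪(WithLp.toLp 2 fun l => fderiv ℝ φ x (stdVec l) : Pow V d), ψ x⟫_ℝ ≤
      ∫ x, ‖ψ x‖ := by
    refine integral_mono hint.neg hψi fun x => ?_
    by_cases hx : x ∈ interior Ω
    · have hg : (WithLp.toLp 2 fun l => fderiv ℝ φ x (stdVec l) : Pow V d) = grad Ω φ x := by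
        rw [grad, fderivWithin_of_mem_nhds (mem_interior_iff_mem_nhds.1 hx)]
      simp only [hg]
      calc -⟪grad Ω φ x, ψ x⟫_ℝ ≤ |⟪grad Ω φ x, ψ x⟫_ℝ| := neg_le_abs _
        _ ≤ ‖grad Ω φ x‖ * ‖ψ x‖ := abs_real_inner_le_norm _ _
        _ ≤ 1 * ‖ψ x‖ := by gcongr; exact hgrad x (interior_subset hx)
        _ = ‖ψ x‖ := one_mul _
    · simp [hψ.eq_zero hx]
  exact_mod_cast this.trans hle

theorem continuousOn_grad (hΩ : UniqueDiffOn ℝ Ω) {φ : EuclideanSpace ℝ (Fin d) → V}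
    (hφ : ContDiffOn ℝ 1 φ Ω) : ContinuousOn (grad Ω φ) Ω := by
  refine (PiLp.continuous_toLp 2 _).comp_continuousOn (continuousOn_pi.2 fun l => ?_)
  exact (hφ.continuousOn_fderivWithin hΩ le_rfl).clm_apply continuousOn_const

theorem grad_add (hΩ : UniqueDiffOn ℝ Ω) {φ χ : EuclideanSpace ℝ (Fin d) → V}
    (hφ : ContDiffOn ℝ 1 φ Ω) (hχ : ContDiffOn ℝ 1 χ Ω) {x : EuclideanSpace ℝ (Fin d)}
    (hx : x ∈ Ω) : grad Ω (φ + χ) x = grad Ω φ x + grad Ω χ x := by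
  ext l
  simp [grad, fderivWithin_add (hΩ x hx) (hφ.differentiableOn one_ne_zero x hx)
    (hχ.differentiableOn one_ne_zero x hx)]

theorem grad_smul (hΩ : UniqueDiffOn ℝ Ω) {φ : EuclideanSpace ℝ (Fin d) → V}
    (hφ : ContDiffOn ℝ 1 φ Ω) (c : ℝ) {x : EuclideanSpace ℝ (Fin d)}
    (hx : x ∈ Ω) : grad Ω (c • φ) x = c • grad Ω φ x := by
  ext l
  simp [grad, fderivWithin_const_smul (hΩ x hx) (hφ.differentiableOn one_ne_zero x hx)]

end Gradient

/-! ### Smooth approximation of dual competitors -/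

section Approximation

open scoped Convolution

variable {d : ℕ} {V : Type*} [NormedAddCommGroup V] [InnerProductSpace ℝ V]
  {Ω : Set (EuclideanSpace ℝ (Fin d))}

/-- The mollified, translated constant field `y ↦ -η(z - y) A`. -/
def kernelField (η : EuclideanSpace ℝ (Fin d) → ℝ) (z : EuclideanSpace ℝ (Fin d)) (A : Pow V d)
    (y : EuclideanSpace ℝ (Fin d)) : Pow V d := -(η (z - y) • A)

/-- The sign in `kernelField` cancels the one from differentiating η(z - y) in `y`. Integrating the
result against `Φ` therefore gives ⟨A, ∇(Φ ⋆ η)(z)⟩. -/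
theorem divergence_kernelField {η : EuclideanSpace ℝ (Fin d) → ℝ} (hη : ContDiff ℝ ∞ η)
    (z : EuclideanSpace ℝ (Fin d)) (A : Pow V d) (y : EuclideanSpace ℝ (Fin d)) :
    divergence (kernelField η z A) y = ∑ l, fderiv ℝ η (z - y) (stdVec l) • A l := by
  refine Finset.sum_congr rfl fun l _ => ?_
  have h1 : HasFDerivAt η (fderiv ℝ η (z - y)) (z - y) :=
    (hη.differentiable (by simp) _).hasFDerivAt
  have h2 : HasFDerivAt (fun y => z - y) (-ContinuousLinearMap.id ℝ (EuclideanSpace ℝ (Fin d))) y :=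
    (hasFDerivAt_id y).const_sub z
  have h3 : HasFDerivAt (fun y => kernelField η z A y l) _ y := ((h1.comp y h2).smul_const (A l)).neg
  rw [h3.fderiv]
  simp

theorem isTestField_kernelField {η : EuclideanSpace ℝ (Fin d) → ℝ} (hη : ContDiff ℝ ∞ η)
    {z : EuclideanSpace ℝ (Fin d)} {ρ : ℝ} (hsupp : tsupport η ⊆ Metric.closedBall 0 ρ)
    (hball : Metric.closedBall z ρ ⊆ interior Ω) (A : Pow V d) :
    IsTestField Ω (kernelField η z A) := by
  have hs : tsupport (kernelField η z A) ⊆ Metric.closedBall z ρ := by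
    refine closure_minimal (fun y hy => ?_) Metric.isClosed_closedBall
    have : η (z - y) ≠ 0 := fun h => hy (by simp [kernelField, h])
    have := hsupp (subset_tsupport η this)
    rwa [mem_closedBall_zero_iff, ← dist_eq_norm, dist_comm] at this
  refine ⟨?_, HasCompactSupport.of_support_subset_isCompact (isCompact_closedBall z ρ)
    ((subset_tsupport _).trans hs), hs.trans hball⟩
  exact ((hη.comp (contDiff_const.sub contDiff_id)).smul contDiff_const).neg

/-- Mollification of a function with `|∇φ|_∞ ≤ 1` has gradient at most one at points of `Ω` which
are far enough from the boundary. -/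
theorem norm_grad_convolution_le_one [FiniteDimensional ℝ V] (hΩ : IsClosed Ω) (φ : C(Ω, V))
    (hφ : frLipConst φ ≤ 1)
    {Φ : EuclideanSpace ℝ (Fin d) → V} (hΦ : Continuous Φ) (hΦφ : ∀ x : Ω, Φ x = φ x)
    {η : EuclideanSpace ℝ (Fin d) → ℝ} (hη : ContDiff ℝ ∞ η) (hη0 : ∀ x, 0 ≤ η x)
    (hη1 : ∫ x, η x = 1) {ρ : ℝ} (hsupp : tsupport η ⊆ Metric.closedBall 0 ρ)
    {z : EuclideanSpace ℝ (Fin d)} (hball : Metric.closedBall z ρ ⊆ interior Ω) :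
    ‖(WithLp.toLp 2 fun l =>
      fderiv ℝ (Φ ⋆[(ContinuousLinearMap.lsmul ℝ ℝ).flip, volume] η) z (stdVec l) : Pow V d)‖
      ≤ 1 := by
  set G : Pow V d := WithLp.toLp 2 fun l =>
      fderiv ℝ (Φ ⋆[(ContinuousLinearMap.lsmul ℝ ℝ).flip, volume] η) z (stdVec l) with hG
  have hηc : HasCompactSupport η := HasCompactSupport.of_support_subset_isCompact
    (isCompact_closedBall 0 ρ) ((subset_tsupport _).trans hsupp)
  have hη1' : ContDiff ℝ 1 η := hη.of_le (by simp)
  have hcomp : ∀ l, G l = ∫ y, fderiv ℝ η (z - y) (stdVec l) • Φ y := fun l => by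
    have := (hηc.hasFDerivAt_convolution_right (ContinuousLinearMap.lsmul ℝ ℝ).flip
      (hΦ.locallyIntegrable (μ := volume)) hη1' z).fderiv
    simp only [hG]
    rw [this, convolution_precompR_apply _ hΦ.locallyIntegrable (hηc.fderiv ℝ)
      (hη1'.continuous_fderiv one_ne_zero)]
    rfl
  have hint : ∀ l, Integrable fun y => fderiv ℝ η (z - y) (stdVec l) • Φ y := fun l => by
    refine Continuous.integrable_of_hasCompactSupport ?_ ?_
    · exact (((hη1'.continuous_fderiv one_ne_zero).comp (by fun_prop)).clm_apply
        continuous_const).smul hΦ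
    · refine HasCompactSupport.of_support_subset_isCompact (isCompact_closedBall z ρ) fun y hy => ?_
      by_contra h
      have : z - y ∉ tsupport η := fun h' => h (by
        have := hsupp h'
        rwa [mem_closedBall_zero_iff, ← dist_eq_norm, dist_comm] at this)
      exact hy (by beta_reduce; rw [fderiv_of_notMem_tsupport ℝ this, zero_apply, zero_smul])
  -- The test field `kernelField η z A` has L¹ norm `‖A‖`, because `η` is nonnegative of integral
  -- one. Taking `A = G / ‖G‖` afterwards bounds `‖G‖`.
  have key : ∀ A : Pow V d, ‖A‖ ≤ 1 → ⟪A, G⟫_ℝ ≤ 1 := fun A hA => by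
    have htest := isTestField_kernelField hη hsupp hball A
    have hnorm : ∫ x : Ω, ‖kernelField η z A x‖ ∂lebesgueOn Ω ≤ 1 := by
      rw [integral_lebesgueOn_eq_integral (f := fun x => ‖kernelField η z A x‖) hΩ
        fun x hx => by rw [htest.eq_zero fun h => hx (interior_subset h), norm_zero]]
      simp only [kernelField, norm_neg, norm_smul, Real.norm_eq_abs, abs_of_nonneg (hη0 _)]
      rw [integral_mul_const, integral_sub_left_eq_self η volume z, hη1, one_mul]
      exact hA
    have hle : ((∫ x : Ω, ⟪φ x, divergence (kernelField η z A) x⟫_ℝ ∂lebesgueOn Ω : ℝ) : EReal)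
        ≤ 1 := by
      refine le_trans (le_iSup_of_le (kernelField η z A) ?_) hφ
      rw [iSup_pos htest, iSup_pos hnorm]
    have hle' : ∫ x : Ω, ⟪φ x, divergence (kernelField η z A) x⟫_ℝ ∂lebesgueOn Ω ≤ 1 := by
      exact_mod_cast hle
    simp only [← hΦφ] at hle'
    rw [integral_lebesgueOn_eq_integral
      (f := fun x => ⟪Φ x, divergence (kernelField η z A) x⟫_ℝ) hΩ fun x hx => by
        simp [htest.divergence_eq_zero fun h => hx (interior_subset h)]] at hle'
    refine le_of_eq_of_le ?_ hle'
    rw [PiLp.inner_apply]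
    simp only [divergence_kernelField hη, inner_sum, inner_smul_right]
    rw [integral_finsetSum]
    · refine Finset.sum_congr rfl fun l _ => ?_
      rw [hcomp l, ← integral_inner (hint l)]
      refine integral_congr_ae (Eventually.of_forall fun y => ?_)
      simp only [inner_smul_right]
      rw [real_inner_comm]
    · intro l _
      refine ((hint l).const_inner (A l)).congr (Eventually.of_forall fun y => ?_)
      simp only [inner_smul_right]
      rw [real_inner_comm]
  rcases eq_or_ne G 0 with h0 | h0
  · simp [h0]
  · have := key (‖G‖⁻¹ • G) (by rw [norm_smul, norm_inv, norm_norm, inv_mul_cancel₀ (by simpa)])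
    rwa [real_inner_smul_left, real_inner_self_eq_norm_sq, sq, ← mul_assoc,
      inv_mul_cancel₀ (by simpa), one_mul] at this

/-- Continuous functions with `|∇φ|_∞ ≤ 1` on a compact convex body are uniform limits of smooth
functions with gradient at most one. -/
theorem exists_contDiff_approx [FiniteDimensional ℝ V] (hΩc : IsCompact Ω) (hΩconv : Convex ℝ Ω)
    (hΩint : (interior Ω).Nonempty) (φ : C(Ω, V)) (hφ : frLipConst φ ≤ 1) {ε : ℝ} (hε : 0 < ε) :
    ∃ g : EuclideanSpace ℝ (Fin d) → V, ContDiff ℝ 1 g ∧ (∀ x ∈ Ω, ‖grad Ω g x‖ ≤ 1) ∧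
      ∀ x : Ω, ‖φ x - g x‖ ≤ ε := by
  have : CompactSpace Ω := isCompact_iff_compactSpace.1 hΩc
  have hΩ := hΩc.isClosed
  obtain ⟨Φ, hΦ⟩ := φ.exists_extension hΩ.isClosedEmbedding_subtypeVal
  have hΦφ : ∀ x : Ω, Φ x = φ x := fun x => by rw [← hΦ]; rfl
  obtain ⟨δ, hδ, hδε⟩ := Metric.uniformContinuous_iff.1
    (CompactSpace.uniformContinuous_of_continuous φ.continuous) (ε / 2) (half_pos hε)
  have hunif : ∀ x ∈ Ω, ∀ y ∈ Ω, dist x y < δ → dist (Φ x) (Φ y) < ε / 2 := fun x hx y hy h => by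
    rw [hΦφ ⟨x, hx⟩, hΦφ ⟨y, hy⟩]
    exact hδε h
  obtain ⟨x₀, hx₀⟩ := hΩint
  obtain ⟨ρ, hρ, hρΩ⟩ := Metric.isOpen_iff.1 isOpen_interior x₀ hx₀
  obtain ⟨R, hR0, hR⟩ : ∃ R > 0, ∀ x ∈ Ω, ‖x - x₀‖ ≤ R := by
    obtain ⟨R, hR⟩ := hΩc.isBounded.subset_closedBall x₀
    exact ⟨max R 1, by positivity, fun x hx => by
      rw [← dist_eq_norm]; exact (Metric.mem_closedBall.1 (hR hx)).trans (le_max_left _ _)⟩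
  obtain ⟨t, ht0, ht1, htR⟩ : ∃ t : ℝ, 0 < t ∧ t < 1 ∧ t * R < δ := by
    refine ⟨min (1 / 2) (δ / (2 * R)), by positivity, ?_, ?_⟩
    · exact (min_le_left _ _).trans_lt (by norm_num)
    · refine (mul_le_mul_of_nonneg_right (min_le_right _ _) hR0.le).trans_lt ?_
      rw [div_mul_eq_mul_div, div_lt_iff₀ (by positivity)]
      nlinarith
  -- The homothety towards `x₀` sends `Ω` to points at depth at least `tρ`, leaving room to mollify.
  -- It moves points by at most `tR < δ`, and its factor `1 - t` does not increase gradients.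
  let a : EuclideanSpace ℝ (Fin d) → EuclideanSpace ℝ (Fin d) := fun x => (1 - t) • x + t • x₀
  have hball : ∀ x ∈ Ω, Metric.ball (a x) (t * ρ) ⊆ Ω := fun x hx y hy => by
    have hy' : x₀ + t⁻¹ • (y - a x) ∈ Ω := by
      refine interior_subset (hρΩ ?_)
      rw [Metric.mem_ball, dist_eq_norm, add_sub_cancel_left, norm_smul, norm_inv,
        Real.norm_of_nonneg ht0.le, inv_mul_lt_iff₀ ht0, ← dist_eq_norm]
      exact hy
    have : y = (1 - t) • x + t • (x₀ + t⁻¹ • (y - a x)) := by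
      rw [smul_add, smul_smul, mul_inv_cancel₀ ht0.ne', one_smul]
      simp only [a]
      abel
    rw [this]
    exact hΩconv hx hy' (by linarith) ht0.le (by ring)
  have haΩ : ∀ x ∈ Ω, a x ∈ Ω := fun x hx =>
    hball x hx (Metric.mem_ball_self (by positivity))
  -- Below `δ` for uniform continuity, below `tρ` to keep the mollifier inside `Ω`.
  let r := min δ (t * ρ) / 2
  have hr : 0 < r := by positivity
  have hrδ : r < δ := (half_lt_self (by positivity)).trans_le (min_le_left _ _)
  have hrρ : r < t * ρ := (half_lt_self (by positivity)).trans_le (min_le_right _ _)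
  have hcball : ∀ x ∈ Ω, Metric.closedBall (a x) r ⊆ interior Ω := fun x hx =>
    (Metric.closedBall_subset_ball hrρ).trans
      (interior_maximal (hball x hx) Metric.isOpen_ball)
  let b : ContDiffBump (0 : EuclideanSpace ℝ (Fin d)) := ⟨r / 2, r, half_pos hr, half_lt_self hr⟩
  let η := b.normed volume
  let h : EuclideanSpace ℝ (Fin d) → V :=
    Φ ⋆[(ContinuousLinearMap.lsmul ℝ ℝ).flip, volume] η
  have hh : ContDiff ℝ 1 h := HasCompactSupport.contDiff_convolution_right (n := 1) _
    b.hasCompactSupport_normed Φ.continuous.locallyIntegrable b.contDiff_normed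
  refine ⟨h ∘ a, hh.comp (by fun_prop), fun x hx => ?_, fun x => ?_⟩
  · have hud : UniqueDiffWithinAt ℝ Ω x := uniqueDiffOn_convex hΩconv ⟨x₀, hx₀⟩ x hx
    have ha : HasFDerivAt a ((1 - t) • ContinuousLinearMap.id ℝ (EuclideanSpace ℝ (Fin d))) x :=
      ((hasFDerivAt_id x).const_smul (1 - t)).add_const _
    have hha : HasFDerivAt h (fderiv ℝ h (a x)) (a x) :=
      (hh.differentiable one_ne_zero _).hasFDerivAt
    have hgr : grad Ω (h ∘ a) x =
        (1 - t) • (WithLp.toLp 2 fun l => fderiv ℝ h (a x) (stdVec l) : Pow V d) := by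
      ext l
      rw [grad, (hha.comp x ha).hasFDerivWithinAt.fderivWithin hud]
      simp
    rw [hgr, norm_smul, Real.norm_of_nonneg (by linarith)]
    refine mul_le_one₀ (by linarith) (norm_nonneg _) ?_
    exact norm_grad_convolution_le_one hΩ φ hφ Φ.continuous hΦφ b.contDiff_normed b.nonneg_normed
      b.integral_normed (b.tsupport_normed_eq).subset (hcball x hx)
  -- Half of `ε` is spent on mollifying, half on the displacement from `x` to `a x`.
  · have h1 : dist (h (a x)) (Φ (a x)) ≤ ε / 2 := by
      have : h = η ⋆[ContinuousLinearMap.lsmul ℝ ℝ, volume] Φ := convolution_flip _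
      rw [this]
      refine b.dist_normed_convolution_le Φ.continuous.aestronglyMeasurable fun y hy => ?_
      refine (hunif y (interior_subset (hcball x x.2 (Metric.ball_subset_closedBall hy))) _
        (haΩ x x.2) ?_).le
      exact (Metric.mem_ball.1 hy).trans hrδ
    have h2 : dist (Φ x) (Φ (a x)) < ε / 2 := by
      refine hunif x x.2 _ (haΩ x x.2) ?_
      have : (x : EuclideanSpace ℝ (Fin d)) - a x = t • (x - x₀) := by
        simp only [a, sub_smul, smul_sub, one_smul]
        abel
      rw [dist_eq_norm, this, norm_smul, Real.norm_of_nonneg ht0.le]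
      exact (mul_le_mul_of_nonneg_left (hR x x.2) ht0.le).trans_lt htR
    rw [← hΦφ, ← dist_eq_norm]
    refine (dist_triangle_right _ _ (Φ (a x))).trans ?_
    simp only [Function.comp_apply]
    linarith

end Approximation

/-! ### Weak duality and the functional on gradients -/

section Duality

variable {d : ℕ} {V : Type*} [NormedAddCommGroup V] [InnerProductSpace ℝ V]
  [FiniteDimensional ℝ V] {Ω : Set (EuclideanSpace ℝ (Fin d))}

theorem pairing_sub_swap {X W : Type*} [MeasurableSpace X] [NormedAddCommGroup W]
    [InnerProductSpace ℝ W] (f : X → W) (μ ν : VectorMeasure X W) :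
    pairing f (ν - μ) = -pairing f (μ - ν) := by
  rw [← neg_sub μ ν]
  exact VectorMeasure.integral_neg_vectorMeasure

/-- A bound on `∫ ⟨g, δ⟩` for `C¹` functions `g` with gradient at most one extends to all
continuous functions with `|∇φ|_∞ ≤ 1`. -/
theorem pairing_le_of_forall_contDiff (hΩc : IsCompact Ω) (hΩconv : Convex ℝ Ω)
    (hΩint : (interior Ω).Nonempty) (δ : VectorMeasure Ω V) {K : ℝ}
    (hK : ∀ g : EuclideanSpace ℝ (Fin d) → V, ContDiff ℝ 1 g → (∀ x ∈ Ω, ‖grad Ω g x‖ ≤ 1) →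
      pairing (fun x : Ω => g x) δ ≤ K)
    (φ : C(Ω, V)) (hφ : frLipConst φ ≤ 1) : pairing φ δ ≤ K := by
  have : CompactSpace Ω := isCompact_iff_compactSpace.1 hΩc
  refine le_of_forall_pos_le_add fun ε hε => ?_
  have hv : 0 ≤ δ.variation.real univ := measureReal_nonneg
  obtain ⟨g, hg, hgrad, happ⟩ := exists_contDiff_approx hΩc hΩconv hΩint φ hφ
    (ε := ε / (δ.variation.real univ + 1)) (by positivity)
  have h1 := abs_pairing_le δ (f := fun x : Ω => φ x - g x) happ
  have h2 : pairing (fun x : Ω => φ x - g x) δ = pairing φ δ - pairing (fun x : Ω => g x) δ :=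
    VectorMeasure.integral_fun_sub (vectorMeasure_integrable δ φ.continuous)
      (vectorMeasure_integrable δ (hg.continuous.comp continuous_subtype_val))
  have h3 : ε / (δ.variation.real univ + 1) * δ.variation.real univ ≤ ε := by
    rw [div_mul_eq_mul_div, div_le_iff₀ (by positivity)]
    nlinarith
  have h4 := (le_abs_self _).trans (h1.trans h3)
  have h5 := hK g hg hgrad
  linarith

/-- Weak duality. -/
theorem dualValue_le_totalVar (hΩc : IsCompact Ω) (hΩconv : Convex ℝ Ω)
    (hΩint : (interior Ω).Nonempty) {μ ν : VectorMeasure Ω V} {σ : VectorMeasure Ω (Pow V d)}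
    (hσ : HasDivergence σ (μ - ν)) : dualValue μ ν ≤ (totalVar σ : EReal) := by
  have := isFiniteMeasure_variation σ
  refine iSup₂_le fun φ hφ => ?_
  have hv : (totalVar σ : EReal) = (σ.variation.real univ : ℝ) :=
    (EReal.coe_ennreal_toReal (measure_ne_top _ _)).symm
  rw [hv, EReal.coe_le_coe_iff]
  refine pairing_le_of_forall_contDiff hΩc hΩconv hΩint _ (fun g hg hgrad => ?_) φ hφ
  rw [pairing_sub_swap, ← hσ g hg.contDiffOn, neg_neg, ← one_mul (σ.variation.real univ)]
  exact (le_abs_self _).trans (abs_pairing_le σ fun x => hgrad x x.2)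

/-- The dual problem has finite value. -/
theorem exists_dualValue_le (hΩc : IsCompact Ω) (hΩconv : Convex ℝ Ω)
    (hΩint : (interior Ω).Nonempty) {μ ν : VectorMeasure Ω V} (hmass : μ univ = ν univ) :
    ∃ K : ℝ, dualValue μ ν ≤ K := by
  have : CompactSpace Ω := isCompact_iff_compactSpace.1 hΩc
  obtain ⟨x₀, hx₀⟩ := hΩint
  obtain ⟨R, hR⟩ := hΩc.isBounded.subset_closedBall x₀
  -- Subtracting the constant `g x₀` does not change the pairing, and `g - g x₀` is bounded by the
  -- radius `R` since `g` is 1-Lipschitz on `Ω`.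
  refine ⟨R * (ν - μ).variation.real univ, iSup₂_le fun φ hφ => EReal.coe_le_coe_iff.2 ?_⟩
  refine pairing_le_of_forall_contDiff hΩc hΩconv ⟨x₀, hx₀⟩ _ (fun g hg hgrad => ?_) φ hφ
  have := isFiniteMeasure_variation (ν - μ)
  have h0 : pairing (fun _ : Ω => g x₀) (ν - μ) = 0 := by
    refine (VectorMeasure.integral_const (g x₀)).trans ?_
    simp [hmass]
  have h1 : pairing (fun x : Ω => g x - g x₀) (ν - μ) =
      pairing (fun x : Ω => g x) (ν - μ) - pairing (fun _ : Ω => g x₀) (ν - μ) :=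
    VectorMeasure.integral_fun_sub
      (vectorMeasure_integrable _ (hg.continuous.comp continuous_subtype_val))
      (vectorMeasure_integrable _ continuous_const)
  rw [h0, sub_zero] at h1
  rw [← h1]
  refine (le_abs_self _).trans (abs_pairing_le _ fun x => ?_)
  have h2 := hΩconv.norm_image_sub_le_of_norm_fderivWithin_le (𝕜 := ℝ) (f := g) (C := 1)
    (hg.differentiable one_ne_zero).differentiableOn
    (fun x hx => (norm_le_frobenius _).trans (hgrad x hx)) (interior_subset hx₀) x.2
  rw [one_mul, ← dist_eq_norm (x : EuclideanSpace ℝ (Fin d))] at h2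
  exact h2.trans (hR x.2)

/-- The functions of class `C¹` on `Ω`. -/
def contDiffOnSubmodule (Ω : Set (EuclideanSpace ℝ (Fin d))) (V : Type*) [NormedAddCommGroup V]
    [InnerProductSpace ℝ V] : Submodule ℝ (EuclideanSpace ℝ (Fin d) → V) where
  carrier := {φ | ContDiffOn ℝ 1 φ Ω}
  add_mem' := fun hφ hχ => ContDiffOn.add hφ hχ
  zero_mem' := contDiffOn_const
  smul_mem' := fun c _ hφ => ContDiffOn.const_smul c hφ

/-- The gradient as a linear map from `C¹` functions to continuous fields. -/
noncomputable def gradLinearMap (hΩ : UniqueDiffOn ℝ Ω) :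
    contDiffOnSubmodule Ω V →ₗ[ℝ] C(Ω, Pow V d) where
  toFun φ := ⟨fun x => grad Ω φ.1 x, (continuousOn_grad hΩ φ.2).domRestrict⟩
  map_add' φ χ := by
    ext1 x
    exact grad_add hΩ φ.2 χ.2 x.2
  map_smul' c φ := by
    ext1 x
    exact grad_smul hΩ φ.2 c x.2

/-- The pairing with a fixed vector measure as a linear map on `C¹` functions. -/
noncomputable def pairingLinearMap [CompactSpace Ω] (δ : VectorMeasure Ω V) :
    contDiffOnSubmodule Ω V →ₗ[ℝ] ℝ where
  toFun φ := pairing (fun x : Ω => φ.1 x) δ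
  map_add' φ χ := VectorMeasure.integral_fun_add
    (vectorMeasure_integrable δ (ContDiffOn.continuousOn φ.2).domRestrict)
    (vectorMeasure_integrable δ (ContDiffOn.continuousOn χ.2).domRestrict)
  map_smul' c _ := VectorMeasure.integral_fun_smul _ _ c _

/-- The pairing of a `C¹` function is bounded by the dual value times the norm of its gradient. -/
theorem abs_pairingLinearMap_le [CompactSpace Ω] (hΩ : UniqueDiffOn ℝ Ω)
    {μ ν : VectorMeasure Ω V} {s : ℝ} (hs0 : 0 ≤ s) (hs : dualValue μ ν ≤ s)
    (φ : contDiffOnSubmodule Ω V) :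
    |pairingLinearMap (ν - μ) φ| ≤ s * ‖gradLinearMap hΩ φ‖ := by
  have hcl : IsClosed Ω := (isCompact_iff_compactSpace.2 ‹_›).isClosed
  have unit : ∀ φ : contDiffOnSubmodule Ω V, ‖gradLinearMap hΩ φ‖ ≤ 1 →
      pairingLinearMap (ν - μ) φ ≤ s := fun φ hφ => by
    let φ' : C(Ω, V) := ⟨fun x => φ.1 x, (ContDiffOn.continuousOn φ.2).domRestrict⟩
    have hadm : frLipConst φ' ≤ 1 := frLipConst_le_one hcl φ.2
      (fun x hx => ((gradLinearMap hΩ φ).norm_coe_le_norm ⟨x, hx⟩).trans hφ) φ' fun x => rfl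
    have h : ((pairing φ' (ν - μ) : ℝ) : EReal) ≤ s := by
      refine le_trans (le_iSup_of_le φ' ?_) hs
      rw [iSup_pos hadm]
    exact EReal.coe_le_coe_iff.1 h
  have main : ∀ φ : contDiffOnSubmodule Ω V,
      pairingLinearMap (ν - μ) φ ≤ s * ‖gradLinearMap hΩ φ‖ := fun φ => by
    refine le_of_forall_pos_le_add fun ε hε => ?_
    -- The added term allows normalising even when the gradient vanishes, at a cost of at most `ε`.
    have hc : 0 < ‖gradLinearMap hΩ φ‖ + ε / (s + 1) := by positivity
    have h := unit ((‖gradLinearMap hΩ φ‖ + ε / (s + 1))⁻¹ • φ) (by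
      rw [map_smul, norm_smul, norm_inv, Real.norm_of_nonneg hc.le, inv_mul_le_one₀ hc]
      exact le_add_of_nonneg_right (by positivity))
    rw [map_smul, smul_eq_mul, inv_mul_le_iff₀ hc] at h
    have h3 : s * (ε / (s + 1)) ≤ ε := by
      rw [mul_div_assoc', div_le_iff₀ (by positivity)]
      nlinarith
    nlinarith
  refine abs_le'.2 ⟨main φ, ?_⟩
  have := main (-φ)
  rwa [map_neg, map_neg, norm_neg] at this

end Duality

end VectorBeckmann

/-! ### Strong duality and attainment -/

theorem mainTheorem1 {d : ℕ} {V : Type*} [NormedAddCommGroup V] [InnerProductSpace ℝ V]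
    [FiniteDimensional ℝ V] (Ω : Set (EuclideanSpace ℝ (Fin d))) (hΩc : IsCompact Ω)
    (hΩconv : Convex ℝ Ω) (hΩint : (interior Ω).Nonempty)
    (μ ν : VectorMeasure Ω V) (hmass : μ univ = ν univ) :
    VectorBeckmann.dualValue μ ν = (VectorBeckmann.beckmannValue μ ν : EReal) ∧
      ∃ σ : VectorMeasure Ω (VectorBeckmann.Pow V d),
        VectorBeckmann.HasDivergence σ (μ - ν) ∧
          VectorBeckmann.totalVar σ = VectorBeckmann.beckmannValue μ ν ∧
          VectorBeckmann.totalVar σ < ⊤ := by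
  open VectorBeckmann in
  have : CompactSpace Ω := isCompact_iff_compactSpace.1 hΩc
  have hud : UniqueDiffOn ℝ Ω := uniqueDiffOn_convex hΩconv hΩint
  obtain ⟨K, hK⟩ := exists_dualValue_le hΩc hΩconv hΩint hmass
  have h0 : 0 ≤ dualValue μ ν := by
    have hadm : frLipConst (0 : C(Ω, V)) ≤ 1 :=
      frLipConst_le_one hΩc.isClosed (φ := 0) contDiffOn_const
        (fun x _ => by
          have : grad Ω (0 : EuclideanSpace ℝ (Fin d) → V) x = 0 := by ext l; simp [grad]
          simp [this]) 0 fun _ => rfl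
    refine le_iSup_of_le (0 : C(Ω, V)) ?_
    have : pairing (0 : C(Ω, V)) (ν - μ) = 0 := VectorMeasure.integral_zero
    rw [iSup_pos hadm, this, EReal.coe_zero]
  obtain ⟨s, hs⟩ : ∃ s : ℝ, dualValue μ ν = s :=
    ⟨(dualValue μ ν).toReal, (EReal.coe_toReal (hK.trans_lt (EReal.coe_lt_top K)).ne
      ((EReal.bot_lt_zero).trans_le h0).ne').symm⟩
  have hs0 : 0 ≤ s := by rwa [hs, EReal.coe_nonneg] at h0
  -- `L` extends ∇φ ↦ ∫⟨φ, ν - μ⟩. The minus sign in `HasDivergence` turns `ν - μ` into `μ - ν`.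
  obtain ⟨L, hL, hLs⟩ := exists_clm_comp_eq_of_abs_le (gradLinearMap hud)
    (pairingLinearMap (ν - μ)) hs0 (abs_pairingLinearMap_le hud hs0 hs.le)
  obtain ⟨σ, hσL, hσ⟩ := exists_vectorMeasure_pairing_eq L
  have hdiv : HasDivergence σ (μ - ν) := fun φ hφ => by
    have h1 := (hσ (gradLinearMap hud ⟨φ, hφ⟩)).trans (hL ⟨φ, hφ⟩)
    have h2 : pairing (fun x : Ω => grad Ω φ x) σ = pairing (fun x : Ω => φ x) (ν - μ) := h1
    rw [h2, pairing_sub_swap, neg_neg]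
  have hσs : totalVar σ ≤ ENNReal.ofReal s := hσL.trans (ENNReal.ofReal_le_ofReal hLs)
  have hle : ∀ σ' : VectorMeasure Ω (Pow V d), HasDivergence σ' (μ - ν) →
      ENNReal.ofReal s ≤ totalVar σ' := fun σ' h' => by
    have := dualValue_le_totalVar hΩc hΩconv hΩint h'
    rw [hs] at this
    rwa [← EReal.coe_ennreal_le_coe_ennreal_iff, EReal.coe_ennreal_ofReal, max_eq_left hs0]
  have hσe : totalVar σ = ENNReal.ofReal s := le_antisymm hσs (hle σ hdiv)
  have hb : beckmannValue μ ν = ENNReal.ofReal s :=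
    le_antisymm ((iInf₂_le σ hdiv).trans hσs) (le_iInf₂ hle)
  refine ⟨?_, σ, hdiv, hσe.trans hb.symm, hσe ▸ ENNReal.ofReal_lt_top⟩
  rw [hb, hs, EReal.coe_ennreal_ofReal, max_eq_left hs0]
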